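/- Let $\mathbb{O}$ denote the complexified octonions, an $8$-dimensional non-associative $\mathbb{C}$-algebra with its $\mathbb{C}$-linear conjugation $z\mapsto\overline z$; put $\mathrm{Re}(z)=\frac{z+\overline z}{2}\in\mathbb{C}$ and $|z|^2=z\overline z\in\mathbb{C}$. For $a\in\mathbb{O}$ let $L_a$ and $R_a$ be the $8\times 8$ complex matrices, in the canonical (orthonormal) basis of $\mathbb{O}$, of the left multiplication $x\mapsto ax$ and the right multiplication $x\mapsto xa$. For $$A=\begin{pmatrix}\lambda_1&c&\overline b\\ \overline c&\lambda_2&a\\ b&\overline a&\lambda_3\end{pmatrix},\qquad a,b,c\in\mathbb{O},\ \lambda_1,\lambda_2,\lambda_3\in\mathbb{C},$$ put $\det_{\mathbb{O}}(A)=\lambda_1\lambda_2\lambda_3+2\mathrm{Re}(cab)-\lambda_2|b|^2-\lambda_1|a|^2-\lambda_3|c|^2$ (the real part of a triple product does not depend on the bracketing) and $$N_A=\begin{pmatrix}\lambda_1 I_8&R_c&{}^tL_b\\ {}^tR_c&\lambda_2 I_8&L_a\\ L_b&{}^tL_a&\lambda_3 I_8\end{pmatrix}.$$ **Theorem.** The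 degeneracy locus of $N_A$, that is, the set of all $A$ for which the $24\times 24$ matrix $N_A$ is not of full rank, is given by the equation $$\bigl(\det_{\mathbb{O}}(A)-2\mathrm{Re}(cab)+2\mathrm{Re}(\overline c ba)\bigr)^4\cdot\mathfrak{S}^2=0,$$ where $$\begin{aligned}\mathfrak{S}={}&\bigl(\lambda_1|a|^2+\lambda_2|b|^2+\lambda_3|c|^2-\lambda_1\lambda_2\lambda_3\bigr)^2\\&-4\bigl(\lambda_1|a|^2+\lambda_2|b|^2+\lambda_3|c|^2-\lambda_1\lambda_2\lambda_3\bigr)\mathrm{Re}(c)\,\mathrm{Re}(ab)\\&+4\bigl(|a|^2|b|^2\mathrm{Re}(c)^2+|c|^2\mathrm{Re}(ab)^2-|a|^2|b|^2|c|^2\bigr).\end{aligned}$$ This holds also with multiplicities: for all $A$, $$\det N_A=\bigl(\det_{\mathbb{O}}(A)-2\mathrm{Re}(cab)+2\mathrm{Re}(\overline c ba)\bigr)^4\cdot\mathfrak{S}^2.$$ -/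

import Mathlib

open scoped Quaternion

noncomputable section

/-- The complexified octonions `𝕆 ⊗ ℂ`, as the Cayley-Dickson double `H ⊕ H e` of the complexified
quaternions `H = ℍ[ℂ]`; the element `⟨x, y⟩` is `x + y e`. -/
@[ext]
structure ComplexOctonion where
  /-- the component in `H` -/
  fst : ℍ[ℂ]
  /-- the coefficient in `H` of `e` -/
  snd : ℍ[ℂ]

namespace ComplexOctonion

instance : Zero ComplexOctonion := ⟨⟨0, 0⟩⟩
instance : One ComplexOctonion := ⟨⟨1, 0⟩⟩
instance : Add ComplexOctonion := ⟨fun u v => ⟨u.fst + v.fst, u.snd + v.snd⟩⟩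
instance : Neg ComplexOctonion := ⟨fun u => ⟨-u.fst, -u.snd⟩⟩
instance : Sub ComplexOctonion := ⟨fun u v => ⟨u.fst - v.fst, u.snd - v.snd⟩⟩
instance : SMul ℂ ComplexOctonion := ⟨fun k u => ⟨k • u.fst, k • u.snd⟩⟩
instance : SMul ℕ ComplexOctonion := ⟨fun k u => ⟨k • u.fst, k • u.snd⟩⟩
instance : SMul ℤ ComplexOctonion := ⟨fun k u => ⟨k • u.fst, k • u.snd⟩⟩

/-- The octonion product, from the rules `u (v e) = (v u) e`, `(u e) (v e) = - v̄ u` and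
`(u e) v = (u v̄) e` for `u`, `v` in `H`. -/
instance : Mul ComplexOctonion :=
  ⟨fun u v => ⟨u.fst * v.fst - star v.snd * u.snd, v.snd * u.fst + u.snd * star v.fst⟩⟩

/-- Octonionic conjugation (`ℂ`-linear): the conjugate of `x + y e` is `x̄ - y e`. Here `star` on
`ℍ[ℂ]` is the `ℂ`-linear quaternionic conjugation. -/
instance : Star ComplexOctonion := ⟨fun u => ⟨star u.fst, -u.snd⟩⟩

@[simp] theorem fst_zero : (0 : ComplexOctonion).fst = 0 := rfl
@[simp] theorem snd_zero : (0 : ComplexOctonion).snd = 0 := rfl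
@[simp] theorem fst_one : (1 : ComplexOctonion).fst = 1 := rfl
@[simp] theorem snd_one : (1 : ComplexOctonion).snd = 0 := rfl
@[simp] theorem fst_add (u v : ComplexOctonion) : (u + v).fst = u.fst + v.fst := rfl
@[simp] theorem snd_add (u v : ComplexOctonion) : (u + v).snd = u.snd + v.snd := rfl
@[simp] theorem fst_smul (k : ℂ) (u : ComplexOctonion) : (k • u).fst = k • u.fst := rfl
@[simp] theorem snd_smul (k : ℂ) (u : ComplexOctonion) : (k • u).snd = k • u.snd := rfl
@[simp] theorem fst_mul (u v : ComplexOctonion) :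
    (u * v).fst = u.fst * v.fst - star v.snd * u.snd := rfl
@[simp] theorem snd_mul (u v : ComplexOctonion) :
    (u * v).snd = v.snd * u.fst + u.snd * star v.fst := rfl
@[simp] theorem fst_star (u : ComplexOctonion) : (star u).fst = star u.fst := rfl
@[simp] theorem snd_star (u : ComplexOctonion) : (star u).snd = -u.snd := rfl

/-- The underlying pair of quaternions. -/
def toProd (u : ComplexOctonion) : ℍ[ℂ] × ℍ[ℂ] := (u.fst, u.snd)

theorem toProd_injective : Function.Injective toProd := by
  intro u v h
  exact ComplexOctonion.ext (congrArg Prod.fst h) (congrArg Prod.snd h)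

instance : AddCommGroup ComplexOctonion :=
  toProd_injective.addCommGroup toProd rfl (fun _ _ => rfl) (fun _ => rfl) (fun _ _ => rfl)
    (fun _ _ => rfl) (fun _ _ => rfl)

instance : Module ℂ ComplexOctonion :=
  Function.Injective.module ℂ ⟨⟨toProd, rfl⟩, fun _ _ => rfl⟩ toProd_injective (fun _ _ => rfl)

instance : NonAssocRing ComplexOctonion where
  left_distrib u v w := by
    apply ComplexOctonion.ext <;> ext <;> simp <;> ring
  right_distrib u v w := by
    apply ComplexOctonion.ext <;> ext <;> simp <;> ring
  zero_mul u := by apply ComplexOctonion.ext <;> simp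
  mul_zero u := by apply ComplexOctonion.ext <;> simp
  one_mul u := by apply ComplexOctonion.ext <;> simp
  mul_one u := by apply ComplexOctonion.ext <;> simp

instance : SMulCommClass ℂ ComplexOctonion ComplexOctonion where
  smul_comm k u v := by
    apply ComplexOctonion.ext <;> ext <;> simp <;> ring

instance : IsScalarTower ℂ ComplexOctonion ComplexOctonion where
  smul_assoc k u v := by
    apply ComplexOctonion.ext <;> ext <;> simp <;> ring

/-- The real part `Re z ∈ ℂ`, characterised by `z + z̄ = 2 (Re z) · 1`, see `add_star_self`. -/
def re (z : ComplexOctonion) : ℂ := z.fst.re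

/-- The squared norm `|z|² ∈ ℂ`, characterised by `z z̄ = |z|² · 1`, see `mul_star_self`. It is a
complex quadratic form, not a modulus. -/
def normSq (z : ComplexOctonion) : ℂ := (z * star z).re

theorem add_star_self (z : ComplexOctonion) :
    z + star z = (2 * z.re) • (1 : ComplexOctonion) := by
  apply ComplexOctonion.ext <;> ext <;> simp [re, two_mul]

theorem mul_star_self (z : ComplexOctonion) :
    z * star z = z.normSq • (1 : ComplexOctonion) := by
  apply ComplexOctonion.ext <;> ext <;> simp [normSq, re] <;> ring

/-- Coordinates in the canonical basis `1, i, j, k, e, i e, j e, k e` of the octonions. -/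
def coords : ComplexOctonion ≃ₗ[ℂ] (Fin 8 → ℂ) where
  toFun u := ![u.fst.re, u.fst.imI, u.fst.imJ, u.fst.imK,
    u.snd.re, u.snd.imI, u.snd.imJ, u.snd.imK]
  map_add' u v := by
    ext i; fin_cases i <;> simp
  map_smul' k u := by
    ext i; fin_cases i <;> simp
  invFun f := ⟨⟨f 0, f 1, f 2, f 3⟩, ⟨f 4, f 5, f 6, f 7⟩⟩
  left_inv u := rfl
  right_inv f := by
    ext i; fin_cases i <;> rfl

@[simp] theorem coords_apply (u : ComplexOctonion) :
    coords u = ![u.fst.re, u.fst.imI, u.fst.imJ, u.fst.imK,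
      u.snd.re, u.snd.imI, u.snd.imJ, u.snd.imK] := rfl

@[simp] theorem coords_symm_fst_re (f : Fin 8 → ℂ) : (coords.symm f).fst.re = f 0 := rfl
@[simp] theorem coords_symm_fst_imI (f : Fin 8 → ℂ) : (coords.symm f).fst.imI = f 1 := rfl
@[simp] theorem coords_symm_fst_imJ (f : Fin 8 → ℂ) : (coords.symm f).fst.imJ = f 2 := rfl
@[simp] theorem coords_symm_fst_imK (f : Fin 8 → ℂ) : (coords.symm f).fst.imK = f 3 := rfl
@[simp] theorem coords_symm_snd_re (f : Fin 8 → ℂ) : (coords.symm f).snd.re = f 4 := rfl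
@[simp] theorem coords_symm_snd_imI (f : Fin 8 → ℂ) : (coords.symm f).snd.imI = f 5 := rfl
@[simp] theorem coords_symm_snd_imJ (f : Fin 8 → ℂ) : (coords.symm f).snd.imJ = f 6 := rfl
@[simp] theorem coords_symm_snd_imK (f : Fin 8 → ℂ) : (coords.symm f).snd.imK = f 7 := rfl

/-- The canonical basis of the octonions over `ℂ`. -/
def basis : Module.Basis (Fin 8) ℂ ComplexOctonion := Module.Basis.ofEquivFun coords

/-- `L a`: the matrix of left multiplication `x ↦ a x` in the canonical basis. -/
def L (a : ComplexOctonion) : Matrix (Fin 8) (Fin 8) ℂ :=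
  LinearMap.toMatrix basis basis (LinearMap.mulLeft ℂ a)

/-- `R a`: the matrix of right multiplication `x ↦ x a` in the canonical basis. -/
def R (a : ComplexOctonion) : Matrix (Fin 8) (Fin 8) ℂ :=
  LinearMap.toMatrix basis basis (LinearMap.mulRight ℂ a)

end ComplexOctonion

open ComplexOctonion

/-- An element of `J₃(𝕆)`: the octonionic hermitian matrix with rows
`(l₁, c, b̄)`, `(c̄, l₂, a)`, `(b, ā, l₃)`, given by its entries. -/
@[ext]
structure HermitianOctonionMatrix where
  l₁ : ℂ
  l₂ : ℂ
  l₃ : ℂ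
  a : ComplexOctonion
  b : ComplexOctonion
  c : ComplexOctonion

namespace HermitianOctonionMatrix

/-- The octonionic determinant
`l₁ l₂ l₃ + 2 Re(cab) - l₂ |b|² - l₁ |a|² - l₃ |c|²`. -/
def octDet (A : HermitianOctonionMatrix) : ℂ :=
  A.l₁ * A.l₂ * A.l₃ + 2 * (A.c * (A.a * A.b)).re
    - A.l₂ * A.b.normSq - A.l₁ * A.a.normSq - A.l₃ * A.c.normSq

/-- The `24 × 24` matrix with `8 × 8` blocks
`(l₁ I, R_c, ᵗL_b)`, `(ᵗR_c, l₂ I, L_a)`, `(L_b, ᵗL_a, l₃ I)`. -/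
def twistedMatrix (A : HermitianOctonionMatrix) :
    Matrix (Fin 8 ⊕ (Fin 8 ⊕ Fin 8)) (Fin 8 ⊕ (Fin 8 ⊕ Fin 8)) ℂ :=
  Matrix.fromBlocks
    (A.l₁ • (1 : Matrix (Fin 8) (Fin 8) ℂ)) (Matrix.fromCols (R A.c) (L A.b).transpose)
    (Matrix.fromRows (R A.c).transpose (L A.b))
    (Matrix.fromBlocks
      (A.l₂ • (1 : Matrix (Fin 8) (Fin 8) ℂ)) (L A.a)
      (L A.a).transpose (A.l₃ • (1 : Matrix (Fin 8) (Fin 8) ℂ)))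

/-- The degeneracy locus of the twisted matrix: the set of `A` for which it is not of full rank. -/
def twistedDegeneracyLocus : Set HermitianOctonionMatrix :=
  {A | A.twistedMatrix.rank < 24}

/-- The cubic `det(A) - 2 Re(cab) + 2 Re(c̄ba)`. -/
def twistedCubic (A : HermitianOctonionMatrix) : ℂ :=
  A.octDet - 2 * (A.c * (A.a * A.b)).re + 2 * (star A.c * (A.b * A.a)).re

/-- The sextic `𝔖`. -/
def sextic (A : HermitianOctonionMatrix) : ℂ :=
  (A.l₁ * A.a.normSq + A.l₂ * A.b.normSq + A.l₃ * A.c.normSq - A.l₁ * A.l₂ * A.l₃) ^ 2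
    - 4 * (A.l₁ * A.a.normSq + A.l₂ * A.b.normSq + A.l₃ * A.c.normSq - A.l₁ * A.l₂ * A.l₃)
        * A.c.re * (A.a * A.b).re
    + 4 * (A.b.normSq * A.a.normSq * A.c.re ^ 2 + A.c.normSq * (A.a * A.b).re ^ 2
        - A.a.normSq * A.b.normSq * A.c.normSq)

end HermitianOctonionMatrix

end

open scoped Quaternion

noncomputable section

/-! The products `L a * L (star a)` and `R (star c) * R c` are scalar, so two Schur complements
reduce the 24 × 24 determinant to that of the 8 × 8 pencil t + L_a L_b R_c + ᵗ(L_a L_b R_c), where t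
= λ₁λ₂λ₃ − λ₁|a|² − λ₂|b|² − λ₃|c|² (`Matrix.det_fromBlocks_three_smul_one`). It remains to see that
the pencil has determinant `pencilDet` (`det_pencil`).

If a and b lie in the quaternions H, write 𝕆 = H ⊕ He. The block of the pencil on He is the
homothety s = t + 2 Re(c̄ba), so one more Schur complement leaves a map x ↦ αx + mxg + m̄xḡ on H,
whose determinant is explicit. A factor s⁴ splits off: it gives the fourth power of the cubic, and
the cofactor is 𝔖².

In general, if the imaginary parts of a and b span a nondegenerate plane, Gram-Schmidt and an
automorphism of 𝕆 move a and b into H; both sides are invariant under automorphisms. The remaining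
pairs are limits of such pairs along a line, and both sides are continuous. -/

/-! ### Block determinants with a homothety in the lower right corner. -/

/-- For s ≠ 0, a block triangular factor clears C at the cost of a factor sⁿ, which cancels. Both
sides are continuous in s, so s = 0 follows by density. -/
theorem Matrix.det_fromBlocks_smul_one {n : Type*} [Fintype n] [DecidableEq n]
    (A B C : Matrix n n ℂ) (s : ℂ) :
    (Matrix.fromBlocks A B C (s • (1 : Matrix n n ℂ))).det = (s • A - B * C).det := by
  refine congrFun (Continuous.ext_on (f := fun s : ℂ =>
    (Matrix.fromBlocks A B C (s • (1 : Matrix n n ℂ))).det)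
    (g := fun s : ℂ => (s • A - B * C).det) (dense_compl_singleton (0 : ℂ)) ?_ ?_ ?_) s
  · apply Continuous.matrix_det
    apply Continuous.matrix_fromBlocks <;> fun_prop
  · fun_prop
  · intro s hs
    have hs : s ≠ 0 := hs
    have h : Matrix.fromBlocks A B C (s • (1 : Matrix n n ℂ)) *
        Matrix.fromBlocks (s • 1) 0 (-C) 1 = Matrix.fromBlocks (s • A - B * C) B 0 (s • 1) := by
      simp [Matrix.fromBlocks_multiply, sub_eq_add_neg]
    have h2 := congrArg Matrix.det h
    rw [Matrix.det_mul, Matrix.det_fromBlocks_zero₁₂, Matrix.det_fromBlocks_zero₂₁] at h2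
    simp only [Matrix.det_one, mul_one, Matrix.det_smul] at h2
    exact mul_right_cancel₀ (pow_ne_zero _ hs) h2

theorem LinearMap.toMatrix_prod_eq_fromBlocks {V W m n : Type*} [Fintype m] [DecidableEq m]
    [Fintype n] [DecidableEq n] [AddCommGroup V] [Module ℂ V] [AddCommGroup W] [Module ℂ W]
    (v : Module.Basis m ℂ V) (w : Module.Basis n ℂ W) (f : V × W →ₗ[ℂ] V × W) :
    LinearMap.toMatrix (v.prod w) (v.prod w) f = Matrix.fromBlocks
      (LinearMap.toMatrix v v (LinearMap.fst ℂ V W ∘ₗ f ∘ₗ LinearMap.inl ℂ V W))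
      (LinearMap.toMatrix w v (LinearMap.fst ℂ V W ∘ₗ f ∘ₗ LinearMap.inr ℂ V W))
      (LinearMap.toMatrix v w (LinearMap.snd ℂ V W ∘ₗ f ∘ₗ LinearMap.inl ℂ V W))
      (LinearMap.toMatrix w w (LinearMap.snd ℂ V W ∘ₗ f ∘ₗ LinearMap.inr ℂ V W)) := by
  ext (i | i) (j | j) <;> simp [LinearMap.toMatrix_apply]

/-- The determinant of an endomorphism of `V × V` whose lower right block is a homothety. -/
theorem LinearMap.det_of_block_eq_smul_id {V : Type*} [AddCommGroup V] [Module ℂ V]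
    [Module.Finite ℂ V] (f : V × V →ₗ[ℂ] V × V) (s : ℂ)
    (h : ∀ y, (f (0, y)).2 = s • y) :
    LinearMap.det f = LinearMap.det (s • (LinearMap.fst ℂ V V ∘ₗ f ∘ₗ LinearMap.inl ℂ V V) -
      (LinearMap.fst ℂ V V ∘ₗ f ∘ₗ LinearMap.inr ℂ V V) ∘ₗ
        (LinearMap.snd ℂ V V ∘ₗ f ∘ₗ LinearMap.inl ℂ V V)) := by
  classical
  let v := Module.finBasis ℂ V
  have h' : LinearMap.snd ℂ V V ∘ₗ f ∘ₗ LinearMap.inr ℂ V V = s • LinearMap.id := by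
    ext y; simpa using h y
  rw [← LinearMap.det_toMatrix (v.prod v), LinearMap.toMatrix_prod_eq_fromBlocks, h', map_smul,
    LinearMap.toMatrix_id, Matrix.det_fromBlocks_smul_one, ← LinearMap.det_toMatrix v, map_sub,
    map_smul, LinearMap.toMatrix_comp v v v]

/-! ### The pencil on the complexified quaternions. -/

instance : SMulCommClass ℂ ℍ[ℂ] ℍ[ℂ] where
  smul_comm k u v := by ext <;> simp <;> ring

instance : IsScalarTower ℂ ℍ[ℂ] ℍ[ℂ] where
  smul_assoc k u v := by ext <;> simp <;> ring

/-- The endomorphism `x ↦ α x + m x g + m̄ x ḡ` of the complexified quaternions. -/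
def quaternionPencil (α : ℂ) (m g : ℍ[ℂ]) : ℍ[ℂ] →ₗ[ℂ] ℍ[ℂ] where
  toFun x := α • x + m * x * g + star m * x * star g
  map_add' x y := by ext <;> simp <;> ring
  map_smul' k x := by ext <;> simp <;> ring

/-- Coordinates in the basis `1, i, j, k` of the complexified quaternions. -/
def quaternionCoords : ℍ[ℂ] ≃ₗ[ℂ] (Fin 4 → ℂ) where
  toFun u := ![u.re, u.imI, u.imJ, u.imK]
  map_add' u v := by ext i; fin_cases i <;> simp
  map_smul' k u := by ext i; fin_cases i <;> simp
  invFun f := ⟨f 0, f 1, f 2, f 3⟩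
  left_inv u := rfl
  right_inv f := by ext i; fin_cases i <;> rfl

@[simp] theorem quaternionCoords_apply (u : ℍ[ℂ]) :
    quaternionCoords u = ![u.re, u.imI, u.imJ, u.imK] := rfl

@[simp] theorem quaternionCoords_symm_re (f : Fin 4 → ℂ) :
    (quaternionCoords.symm f).re = f 0 := rfl
@[simp] theorem quaternionCoords_symm_imI (f : Fin 4 → ℂ) :
    (quaternionCoords.symm f).imI = f 1 := rfl
@[simp] theorem quaternionCoords_symm_imJ (f : Fin 4 → ℂ) :
    (quaternionCoords.symm f).imJ = f 2 := rfl
@[simp] theorem quaternionCoords_symm_imK (f : Fin 4 → ℂ) :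
    (quaternionCoords.symm f).imK = f 3 := rfl

/-- The basis `1, i, j, k` of the complexified quaternions. -/
def quaternionBasis : Module.Basis (Fin 4) ℂ ℍ[ℂ] := Module.Basis.ofEquivFun quaternionCoords

/-- With m = m₀ + m' and g = g₀ + g', the mixed terms cancel and the map is (α + 2m₀g₀)x + 2m'xg'.
The square of x ↦ m'xg' is the scalar |m'|²|g'|², which explains the shape of the answer; the proof
expands the 4 × 4 determinant. -/
theorem det_quaternionPencil (α : ℂ) (m g : ℍ[ℂ]) :
    LinearMap.det (quaternionPencil α m g) = ((α + 2 * m.re * g.re) ^ 2 -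
      4 * (m.imI ^ 2 + m.imJ ^ 2 + m.imK ^ 2) * (g.imI ^ 2 + g.imJ ^ 2 + g.imK ^ 2)) ^ 2 := by
  rw [← LinearMap.det_toMatrix quaternionBasis]
  have h : LinearMap.toMatrix quaternionBasis quaternionBasis (quaternionPencil α m g) =
    (α + 2 * m.re * g.re) • 1 + (2 : ℂ) • !![
      -(m.imI * g.imI + m.imJ * g.imJ + m.imK * g.imK), m.imJ * g.imK - m.imK * g.imJ,
        m.imK * g.imI - m.imI * g.imK, m.imI * g.imJ - m.imJ * g.imI;
      m.imJ * g.imK - m.imK * g.imJ, -(m.imI * g.imI) + m.imJ * g.imJ + m.imK * g.imK,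
        -(m.imI * g.imJ + m.imJ * g.imI), -(m.imI * g.imK + m.imK * g.imI);
      m.imK * g.imI - m.imI * g.imK, -(m.imI * g.imJ + m.imJ * g.imI),
        m.imI * g.imI - m.imJ * g.imJ + m.imK * g.imK, -(m.imJ * g.imK + m.imK * g.imJ);
      m.imI * g.imJ - m.imJ * g.imI, -(m.imI * g.imK + m.imK * g.imI),
        -(m.imJ * g.imK + m.imK * g.imJ), m.imI * g.imI + m.imJ * g.imJ - m.imK * g.imK] := by
    ext i j
    fin_cases i <;> fin_cases j <;>
      simp [LinearMap.toMatrix_apply, quaternionPencil, quaternionBasis] <;> ring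
  rw [h]
  generalize α + 2 * m.re * g.re = β
  simp [Matrix.det_succ_row_zero, Fin.sum_univ_succ, Matrix.one_apply, Fin.succAbove]
  ring

/-! ### Octonion identities, the form Re(xy), and transposes of `L` and `R`. -/

namespace ComplexOctonion

theorem re_add (x y : ComplexOctonion) : (x + y).re = x.re + y.re := by simp [re]

theorem re_smul (k : ℂ) (x : ComplexOctonion) : (k • x).re = k * x.re := by simp [re]

theorem star_add' (x y : ComplexOctonion) : star (x + y) = star x + star y := by
  apply ComplexOctonion.ext <;> ext <;> simp <;> ring

theorem star_smul' (k : ℂ) (x : ComplexOctonion) : star (k • x) = k • star x := by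
  apply ComplexOctonion.ext <;> ext <;> simp

theorem star_star' (x : ComplexOctonion) : star (star x) = x := by
  apply ComplexOctonion.ext <;> simp

theorem star_mul' (x y : ComplexOctonion) : star (x * y) = star y * star x := by
  apply ComplexOctonion.ext <;> ext <;> simp <;> ring

theorem re_star (x : ComplexOctonion) : (star x).re = x.re := by simp [re]

theorem re_mul_comm (x y : ComplexOctonion) : (x * y).re = (y * x).re := by
  simp [re]; ring

theorem re_mul_assoc (x y z : ComplexOctonion) : (x * y * z).re = (x * (y * z)).re := by
  simp [re]; ring

theorem mul_star_mul_self (x z : ComplexOctonion) : x * (star x * z) = x.normSq • z := by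
  apply ComplexOctonion.ext <;> ext <;> simp [normSq, re] <;> ring

theorem star_mul_mul_self (x z : ComplexOctonion) : star x * (x * z) = x.normSq • z := by
  apply ComplexOctonion.ext <;> ext <;> simp [normSq, re] <;> ring

theorem mul_mul_star_self (x z : ComplexOctonion) : z * x * star x = x.normSq • z := by
  apply ComplexOctonion.ext <;> ext <;> simp [normSq, re] <;> ring

theorem mul_star_mul_self' (x z : ComplexOctonion) : z * star x * x = x.normSq • z := by
  apply ComplexOctonion.ext <;> ext <;> simp [normSq, re] <;> ring

theorem normSq_add (x y : ComplexOctonion) :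
    (x + y).normSq = x.normSq + y.normSq + 2 * (x * star y).re := by
  simp [normSq, re]; ring

/-- Polarisation of x(x̄z) = |x|²z. -/
theorem mul_mul_add_mul_mul (x y z : ComplexOctonion) :
    x * (star y * z) + y * (star x * z) = (2 * (x * star y).re) • z := by
  have h := mul_star_mul_self (x + y) z
  rw [normSq_add, star_add', add_mul, add_mul, mul_add, mul_add, mul_star_mul_self,
    mul_star_mul_self, add_smul, add_smul] at h
  rw [← add_right_inj (x.normSq • z + y.normSq • z), ← h]
  abel

theorem mul_mul_add_mul_mul' (x y z : ComplexOctonion) :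
    z * star x * y + z * star y * x = (2 * (x * star y).re) • z := by
  have h := mul_star_mul_self' (x + y) z
  rw [normSq_add, star_add', mul_add, mul_add, add_mul, add_mul, mul_star_mul_self',
    mul_star_mul_self', add_smul, add_smul] at h
  rw [← add_right_inj (x.normSq • z + y.normSq • z), ← h]
  abel

theorem normSq_mul (x y : ComplexOctonion) : (x * y).normSq = x.normSq * y.normSq := by
  simp [normSq, re]; ring

/-- Nondegeneracy of the bilinear form `Re (x y)`. -/
theorem eq_zero_of_re_mul_eq_zero {x : ComplexOctonion} (h : ∀ y, (x * y).re = 0) : x = 0 := by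
  have key (i : Fin 8) := h (coords.symm (Pi.single i 1))
  simp only [re, fst_mul, Quaternion.re_sub, Quaternion.re_mul, Quaternion.re_star,
    Quaternion.imI_star, Quaternion.imJ_star, Quaternion.imK_star, coords_symm_fst_re,
    coords_symm_fst_imI, coords_symm_fst_imJ, coords_symm_fst_imK, coords_symm_snd_re,
    coords_symm_snd_imI, coords_symm_snd_imJ, coords_symm_snd_imK] at key
  apply ComplexOctonion.ext <;> ext
  · simpa using key 0
  · simpa using key 1
  · simpa using key 2
  · simpa using key 3
  · simpa using key 4
  · simpa using key 5
  · simpa using key 6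
  · simpa using key 7

theorem coords_eq_re (x : ComplexOctonion) (i : Fin 8) : coords x i = (star (basis i) * x).re := by
  rw [basis, Module.Basis.coe_ofEquivFun]
  fin_cases i <;> simp [re]

theorem L_apply (a : ComplexOctonion) (i j : Fin 8) :
    L a i j = (star (basis i) * (a * basis j)).re := by
  rw [← coords_eq_re, L, LinearMap.toMatrix_apply, LinearMap.mulLeft_apply]
  rfl

theorem R_apply (a : ComplexOctonion) (i j : Fin 8) :
    R a i j = (star (basis i) * (basis j * a)).re := by
  rw [← coords_eq_re, R, LinearMap.toMatrix_apply, LinearMap.mulRight_apply]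
  rfl

/-- The canonical basis is orthonormal for Re(x̄y), and for this form the adjoint of multiplication
by a is multiplication by ā. -/
theorem L_transpose (a : ComplexOctonion) : (L a).transpose = L (star a) := by
  ext i j
  rw [Matrix.transpose_apply, L_apply, L_apply, ← re_star (star (basis i) * _), star_mul',
    star_mul', star_star', star_star', re_mul_assoc]

theorem R_transpose (a : ComplexOctonion) : (R a).transpose = R (star a) := by
  ext i j
  rw [Matrix.transpose_apply, R_apply, R_apply, ← re_star (star (basis i) * _), star_mul',
    star_mul', star_star', star_star', re_mul_comm, re_mul_comm (a * _), ← re_mul_assoc,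
    re_mul_assoc]

/-! ### The octonionic pencil when a and b are quaternions. -/

/-- The endomorphism `t + L_a L_b R_c + ᵗ(L_a L_b R_c)`. -/
def pencil (t : ℂ) (a b c : ComplexOctonion) : ComplexOctonion →ₗ[ℂ] ComplexOctonion :=
  t • LinearMap.id +
    LinearMap.mulLeft ℂ a ∘ₗ LinearMap.mulLeft ℂ b ∘ₗ LinearMap.mulRight ℂ c +
    LinearMap.mulRight ℂ (star c) ∘ₗ LinearMap.mulLeft ℂ (star b) ∘ₗ LinearMap.mulLeft ℂ (star a)

theorem pencil_apply (t : ℂ) (a b c x : ComplexOctonion) :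
    pencil t a b c x = t • x + a * (b * (x * c)) + (star b * (star a * x)) * star c := rfl

/-- The value of the determinant of the pencil. -/
def pencilDet (t : ℂ) (a b c : ComplexOctonion) : ℂ :=
  (t + 2 * (star c * (b * a)).re) ^ 4 *
    ((t + 2 * c.re * (a * b).re) ^ 2 -
      4 * (a.normSq * b.normSq - (a * b).re ^ 2) * (c.normSq - c.re ^ 2)) ^ 2

theorem toMatrix_pencil (t : ℂ) (a b c : ComplexOctonion) :
    LinearMap.toMatrix basis basis (pencil t a b c) =
      t • 1 + L a * (L b * R c) + R (star c) * (L (star b) * L (star a)) := by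
  simp only [pencil, map_add, map_smul, LinearMap.toMatrix_id, LinearMap.toMatrix_comp basis basis basis,
    L, R]

theorem det_toMatrix_pencil (t : ℂ) (a b c : ComplexOctonion) :
    (t • 1 + L a * (L b * R c) + R (star c) * (L (star b) * L (star a))).det =
      LinearMap.det (pencil t a b c) := by
  rw [← toMatrix_pencil, LinearMap.det_toMatrix]

/-- The splitting of the octonions as a pair of quaternions, as a linear equivalence. -/
def toProdEquiv : ComplexOctonion ≃ₗ[ℂ] ℍ[ℂ] × ℍ[ℂ] where
  toFun := toProd
  map_add' _ _ := rfl
  map_smul' _ _ := rfl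
  invFun p := ⟨p.1, p.2⟩
  left_inv _ := rfl
  right_inv _ := rfl

theorem quaternion_star_neg (x : ℍ[ℂ]) : star (-x) = -star x := by ext <;> simp

theorem quaternion_neg_mul (x y : ℍ[ℂ]) : -x * y = -(x * y) := neg_mul x y

theorem toProdEquiv_pencil (t : ℂ) (u v : ℍ[ℂ]) (c : ComplexOctonion) (p : ℍ[ℂ] × ℍ[ℂ]) :
    toProdEquiv (pencil t ⟨u, 0⟩ ⟨v, 0⟩ c (toProdEquiv.symm p)) =
      (t • p.1 + u * v * (p.1 * c.fst - star c.snd * p.2) +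
          (star (u * v) * p.1 * star c.fst + star c.snd * p.2 * star (v * u)),
        t • p.2 + (c.snd * p.1 + p.2 * star c.fst) * (v * u) +
          (-(c.snd * star (u * v) * p.1) + p.2 * star (v * u) * c.fst)) := by
  obtain ⟨x, y⟩ := p
  refine Prod.ext ?_ ?_
  · change (pencil t ⟨u, 0⟩ ⟨v, 0⟩ c ⟨x, y⟩).fst = _
    simp only [pencil_apply, fst_add, fst_smul, fst_mul, snd_mul, fst_star, snd_star, zero_mul,
      mul_zero, add_zero, sub_zero, neg_zero, quaternion_star_neg, quaternion_neg_mul, star_mul,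
      sub_neg_eq_add, mul_assoc]
  · change (pencil t ⟨u, 0⟩ ⟨v, 0⟩ c ⟨x, y⟩).snd = _
    simp only [pencil_apply, snd_add, snd_smul, fst_mul, snd_mul, fst_star, snd_star, zero_mul,
      mul_zero, add_zero, sub_zero, neg_zero, quaternion_neg_mul, star_mul, star_star, mul_assoc]

theorem quaternion_mul_add_star (n h : ℍ[ℂ]) :
    star h * n + star n * h = (2 * (star h * n).re) • (1 : ℍ[ℂ]) := by
  ext <;> simp <;> ring

theorem quaternion_star_mul_self (k : ℍ[ℂ]) :
    star k * k = (k.re ^ 2 + k.imI ^ 2 + k.imJ ^ 2 + k.imK ^ 2) • (1 : ℍ[ℂ]) := by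
  ext <;> simp <;> ring

theorem quaternion_mul_star_self (k : ℍ[ℂ]) :
    k * star k = (k.re ^ 2 + k.imI ^ 2 + k.imJ ^ 2 + k.imK ^ 2) • (1 : ℍ[ℂ]) := by
  ext <;> simp <;> ring

theorem quaternion_normSq_mul_comm (u v : ℍ[ℂ]) :
    (v * u).re ^ 2 + (v * u).imI ^ 2 + (v * u).imJ ^ 2 + (v * u).imK ^ 2 =
      (u * v).re ^ 2 + (u * v).imI ^ 2 + (u * v).imJ ^ 2 + (u * v).imK ^ 2 := by
  simp; ring

theorem quaternion_normSq_mul (u v : ℍ[ℂ]) :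
    (u * v).re ^ 2 + (u * v).imI ^ 2 + (u * v).imJ ^ 2 + (u * v).imK ^ 2 =
      (u.re ^ 2 + u.imI ^ 2 + u.imJ ^ 2 + u.imK ^ 2) *
        (v.re ^ 2 + v.imI ^ 2 + v.imJ ^ 2 + v.imK ^ 2) := by
  simp; ring

theorem det_pencil_of_snd_eq_zero (t : ℂ) (u v : ℍ[ℂ]) (c : ComplexOctonion) :
    LinearMap.det (pencil t ⟨u, 0⟩ ⟨v, 0⟩ c) = pencilDet t ⟨u, 0⟩ ⟨v, 0⟩ c := by
  obtain ⟨h, k, hc⟩ : ∃ h k, c = ⟨h, k⟩ := ⟨c.fst, c.snd, rfl⟩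
  set m := u * v with hm
  set n := v * u with hn
  set s := t + 2 * (star h * n).re with hs
  set κ := k.re ^ 2 + k.imI ^ 2 + k.imJ ^ 2 + k.imK ^ 2 with hκ
  set μ := m.re ^ 2 + m.imI ^ 2 + m.imJ ^ 2 + m.imK ^ 2 with hμ
  have hμ' : n.re ^ 2 + n.imI ^ 2 + n.imJ ^ 2 + n.imK ^ 2 = μ := quaternion_normSq_mul_comm u v
  have hre : n.re = m.re := by simp [hm, hn]; ring
  rw [← LinearMap.det_conj _ toProdEquiv, LinearMap.det_of_block_eq_smul_id _ s]
  -- With c = h + ke, the blocks are A x = tx + mxh + m̄xh̄, B y = k̄yn̄ − mk̄y and C x = kxn −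
  -- km̄x. In BC the scalars k̄k = κ and mm̄ = nn̄ = μ come out, and sA − BC is again a quaternionic
  -- pencil.
  · have key : s • (LinearMap.fst ℂ ℍ[ℂ] ℍ[ℂ] ∘ₗ
          (toProdEquiv.toLinearMap ∘ₗ pencil t ⟨u, 0⟩ ⟨v, 0⟩ c ∘ₗ toProdEquiv.symm.toLinearMap) ∘ₗ
          LinearMap.inl ℂ ℍ[ℂ] ℍ[ℂ]) -
        (LinearMap.fst ℂ ℍ[ℂ] ℍ[ℂ] ∘ₗ
          (toProdEquiv.toLinearMap ∘ₗ pencil t ⟨u, 0⟩ ⟨v, 0⟩ c ∘ₗ toProdEquiv.symm.toLinearMap) ∘ₗ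
          LinearMap.inr ℂ ℍ[ℂ] ℍ[ℂ]) ∘ₗ
        (LinearMap.snd ℂ ℍ[ℂ] ℍ[ℂ] ∘ₗ
          (toProdEquiv.toLinearMap ∘ₗ pencil t ⟨u, 0⟩ ⟨v, 0⟩ c ∘ₗ toProdEquiv.symm.toLinearMap) ∘ₗ
          LinearMap.inl ℂ ℍ[ℂ] ℍ[ℂ]) =
        quaternionPencil (s * t - 2 * κ * μ) m (s • h + κ • n) := by
      apply LinearMap.ext
      intro x
      simp only [LinearMap.sub_apply, LinearMap.smul_apply, LinearMap.comp_apply,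
        LinearEquiv.coe_coe, LinearMap.inl_apply, LinearMap.inr_apply, LinearMap.fst_apply,
        LinearMap.snd_apply, toProdEquiv_pencil, ← hm, ← hn, hc]
      simp only [quaternionPencil, LinearMap.coe_mk, AddHom.coe_mk]
      have e1 : star k * k = κ • (1 : ℍ[ℂ]) := quaternion_star_mul_self k
      have e2 : n * star n = μ • (1 : ℍ[ℂ]) := by rw [quaternion_mul_star_self, hμ']
      have e3 : m * star m = μ • (1 : ℍ[ℂ]) := quaternion_mul_star_self m
      have e4 : star k * (k * x * n - k * star m * x) * star n = (κ * μ) • x - κ • (star m * x * star n) := by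
        have : star k * (k * x * n - k * star m * x) * star n =
          (star k * k) * x * (n * star n) - (star k * k) * star m * x * star n := by simp only [mul_sub, sub_mul, mul_assoc]
        rw [this, e1, e2]
        simp only [smul_mul_assoc, mul_smul_comm, one_mul, mul_one, smul_smul]
        rw [mul_comm]
      have e5 : m * (star k * (k * x * n - k * star m * x)) = κ • (m * x * n) - (κ * μ) • x := by
        have : m * (star k * (k * x * n - k * star m * x)) =
          m * (star k * k) * x * n - m * (star k * k) * star m * x := by simp only [mul_sub, mul_assoc]
        rw [this, e1]
        simp only [smul_mul_assoc, mul_smul_comm, mul_one, e3, one_mul, smul_smul]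
      have e6 : star (s • h + κ • n) = s • star h + κ • star n := by
        ext <;> simp [add_comm]
      simp only [smul_zero, zero_mul, mul_zero, add_zero, zero_add, sub_zero, zero_sub, e6]
      have e7 : k * x * n + -(k * star m * x) = k * x * n - k * star m * x := by abel
      have e8 (z : ℍ[ℂ]) : m * -z = -(m * z) := mul_neg m z
      rw [e7, e8, e4, e5]
      simp only [mul_add, mul_smul_comm, mul_assoc]
      module
    rw [key, det_quaternionPencil]
    have hρ : (star c * (⟨v, 0⟩ * ⟨u, 0⟩ : ComplexOctonion)).re = (star h * n).re := by
      simp [re, hc, hn]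
    have hq : ((⟨u, 0⟩ * ⟨v, 0⟩ : ComplexOctonion)).re = m.re := by simp [re, hm]
    have hc0 : c.re = h.re := by simp [re, hc]
    have hN (w : ComplexOctonion) : w.normSq = (w.fst.re ^ 2 + w.fst.imI ^ 2 + w.fst.imJ ^ 2 +
        w.fst.imK ^ 2) + (w.snd.re ^ 2 + w.snd.imI ^ 2 + w.snd.imJ ^ 2 + w.snd.imK ^ 2) := by
      simp [normSq, re]; ring
    have hab : (⟨u, 0⟩ : ComplexOctonion).normSq * (⟨v, 0⟩ : ComplexOctonion).normSq = μ := by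
      rw [hμ, hm, quaternion_normSq_mul, hN, hN]; simp
    rw [pencilDet, hρ, hq, hab, hc0, ← hs, hN, hc]
    have e1 : (s • h + κ • n).imI ^ 2 + (s • h + κ • n).imJ ^ 2 + (s • h + κ • n).imK ^ 2 =
      s ^ 2 * (h.re ^ 2 + h.imI ^ 2 + h.imJ ^ 2 + h.imK ^ 2) + 2 * s * κ * (star h * n).re +
        κ ^ 2 * μ - (s * h.re + κ * n.re) ^ 2 := by
      rw [← hμ']; simp; ring
    have e2 : (s • h + κ • n).re = s * h.re + κ * m.re := by simp [hre]
    have e3 : m.imI ^ 2 + m.imJ ^ 2 + m.imK ^ 2 = μ - m.re ^ 2 := by rw [hμ]; ring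
    have e4 : (star h * n).re = (s - t) / 2 := by rw [hs]; ring
    -- Put T = t + 2h₀m₀ and ν = μ − m₀². Then α + 2m₀g₀ = sT − 2κν and |g'|² = s²(|c|² − h₀²) − sκT
    -- + κ²ν, so in (α + 2m₀g₀)² − 4ν|g'|² all terms not divisible by s² cancel.
    rw [e1, e2, e3, e4, hre]
    change _ = s ^ 4 * ((t + 2 * h.re * m.re) ^ 2 - 4 * (μ - m.re ^ 2) *
      (h.re ^ 2 + h.imI ^ 2 + h.imJ ^ 2 + h.imK ^ 2 + κ - h.re ^ 2)) ^ 2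
    generalize h.re ^ 2 + h.imI ^ 2 + h.imJ ^ 2 + h.imK ^ 2 = η
    generalize h.re = h₀
    generalize m.re = m₀
    clear_value s κ μ
    ring
  · intro y
    simp only [LinearMap.comp_apply, LinearEquiv.coe_coe, toProdEquiv_pencil]
    have := quaternion_mul_add_star n h
    rw [← hn, hc]
    simp only [mul_zero, zero_add, neg_zero, mul_assoc]
    rw [add_assoc, ← mul_add, this, hs, add_smul, mul_smul_comm, mul_one]

/-! ### Cayley-Dickson relations and the automorphisms given by basic triples. -/

theorem star_eq_neg_iff_re_eq_zero {x : ComplexOctonion} : star x = -x ↔ x.re = 0 := by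
  have h := add_star_self x
  constructor
  · intro hx
    rw [hx, add_neg_cancel] at h
    have := congrArg re h
    simpa [re] using this
  · intro hx
    rw [hx, mul_zero, zero_smul] at h
    exact (neg_eq_of_add_eq_zero_right h).symm

theorem mul_mul_of_normSq_eq_one {x : ComplexOctonion} (hx : star x = -x) (hN : x.normSq = 1)
    (z : ComplexOctonion) : x * (x * z) = -z := by
  have h := mul_star_mul_self x z
  rw [hx, hN, neg_mul, mul_neg, one_smul] at h
  exact neg_eq_iff_eq_neg.1 h

theorem mul_mul_of_normSq_eq_one' {x : ComplexOctonion} (hx : star x = -x) (hN : x.normSq = 1)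
    (z : ComplexOctonion) : z * x * x = -z := by
  have h := mul_mul_star_self x z
  rw [hx, hN, mul_neg, one_smul] at h
  exact neg_eq_iff_eq_neg.1 h

theorem mul_anticomm {x y : ComplexOctonion} (hx : star x = -x) (hy : star y = -y)
    (h : (x * y).re = 0) : y * x = -(x * y) := by
  have := star_eq_neg_iff_re_eq_zero.2 h
  rwa [star_mul', hx, hy, neg_mul_neg] at this

theorem mul_eq_mul_star_of_orthogonal {e x : ComplexOctonion} (he : star e = -e)
    (h : (x * e).re = 0) : x * e = e * star x := by
  have := star_eq_neg_iff_re_eq_zero.2 h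
  rw [star_mul', he, neg_mul] at this
  exact (neg_injective this).symm

/-- The polarised identity for u, ē, v̄ has right side 0 because u ⊥ e; moving e to the right by xe
= ex̄ gives the claim. The two companions below come from polarisation in the same way. -/
theorem mul_mul_right_of_orthogonal {e u v : ComplexOctonion} (he : star e = -e)
    (hu : (u * e).re = 0) (hv : (v * e).re = 0) (hvu : (v * u * e).re = 0) :
    u * (v * e) = v * u * e := by
  have h := mul_mul_add_mul_mul u (star e) (star v)
  rw [star_star', hu, mul_zero, zero_smul, ← star_mul', he, neg_mul,
    ← mul_eq_mul_star_of_orthogonal he hvu, ← mul_eq_mul_star_of_orthogonal he hv] at h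
  exact add_neg_eq_zero.1 h

theorem mul_mul_left_of_orthogonal {e u v : ComplexOctonion} (he : star e = -e)
    (hv : (v * e).re = 0) : u * e * v = u * star v * e := by
  have h := mul_mul_add_mul_mul' (star e) v u
  rw [star_star', ← star_mul', re_star, hv, mul_zero, zero_smul, he, mul_neg] at h
  exact add_neg_eq_zero.1 h

theorem mul_mul_mul_of_orthogonal {e u v : ComplexOctonion} (he : star e = -e)
    (hN : e.normSq = 1) (hu : (u * e).re = 0) (hv : (v * e).re = 0)
    (huv : (u * star v * e).re = 0) : u * e * (v * e) = -(star v * u) := by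
  have h := mul_mul_add_mul_mul (u * e) (star v) e
  rw [star_star', mul_mul_left_of_orthogonal he hv, huv, mul_zero, zero_smul,
    star_eq_neg_iff_re_eq_zero.2 hu, neg_mul, mul_mul_of_normSq_eq_one' he hN, neg_neg] at h
  exact eq_neg_of_add_eq_zero_left h

/-- A basic triple: generators of the octonions which satisfy the same relations as `i`, `j`, `e`. -/
structure BasicTriple where
  /-- the image of `i` -/
  i : ComplexOctonion
  /-- the image of `j` -/
  j : ComplexOctonion
  /-- the image of `e` -/
  e : ComplexOctonion
  star_i : star i = -i
  star_j : star j = -j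
  star_e : star e = -e
  normSq_i : i.normSq = 1
  normSq_j : j.normSq = 1
  normSq_e : e.normSq = 1
  re_i_j : (i * j).re = 0
  re_i_e : (i * e).re = 0
  re_j_e : (j * e).re = 0
  re_k_e : (i * j * e).re = 0

namespace BasicTriple

variable (B : BasicTriple)

theorem i_i : B.i * B.i = -1 := by
  simpa using mul_mul_of_normSq_eq_one B.star_i B.normSq_i 1

theorem j_j : B.j * B.j = -1 := by
  simpa using mul_mul_of_normSq_eq_one B.star_j B.normSq_j 1

theorem j_i : B.j * B.i = -(B.i * B.j) := mul_anticomm B.star_i B.star_j B.re_i_j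

theorem i_k : B.i * (B.i * B.j) = -B.j := mul_mul_of_normSq_eq_one B.star_i B.normSq_i _

theorem k_j : B.i * B.j * B.j = -B.i := mul_mul_of_normSq_eq_one' B.star_j B.normSq_j _

theorem j_k : B.j * (B.i * B.j) = B.i := by
  rw [← neg_neg (B.i * B.j), ← j_i, mul_neg, mul_mul_of_normSq_eq_one B.star_j B.normSq_j, neg_neg]

theorem k_i : B.i * B.j * B.i = B.j := by
  rw [← neg_neg (B.i * B.j), ← j_i, neg_mul, mul_mul_of_normSq_eq_one' B.star_i B.normSq_i, neg_neg]

theorem star_k : star (B.i * B.j) = -(B.i * B.j) := star_eq_neg_iff_re_eq_zero.2 B.re_i_j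

theorem k_k : B.i * B.j * (B.i * B.j) = -1 := by
  have := mul_mul_of_normSq_eq_one B.star_k (by rw [normSq_mul, B.normSq_i, B.normSq_j, mul_one]) 1
  simpa only [mul_one] using this

/-- The map on quaternions which sends `i` and `j` to the first two members of the triple. -/
def quaternionMap : ℍ[ℂ] →ₗ[ℂ] ComplexOctonion where
  toFun q := q.re • 1 + q.imI • B.i + q.imJ • B.j + q.imK • (B.i * B.j)
  map_add' x y := by
    simp only [Quaternion.re_add, Quaternion.imI_add, Quaternion.imJ_add, Quaternion.imK_add]
    module
  map_smul' k x := by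
    simp only [Quaternion.re_smul, Quaternion.imI_smul, Quaternion.imJ_smul, Quaternion.imK_smul,
      smul_eq_mul, RingHom.id_apply]
    module

theorem quaternionMap_apply (q : ℍ[ℂ]) :
    B.quaternionMap q = q.re • 1 + q.imI • B.i + q.imJ • B.j + q.imK • (B.i * B.j) := rfl

theorem quaternionMap_mul (x y : ℍ[ℂ]) :
    B.quaternionMap (x * y) = B.quaternionMap x * B.quaternionMap y := by
  simp only [quaternionMap_apply, mul_add, add_mul, smul_mul_assoc, mul_smul_comm, one_mul, mul_one,
    i_i, j_j, j_i, i_k, k_j, j_k, k_i, k_k, Quaternion.re_mul, Quaternion.imI_mul,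
    Quaternion.imJ_mul, Quaternion.imK_mul]
  module

theorem quaternionMap_star (x : ℍ[ℂ]) : B.quaternionMap (star x) = star (B.quaternionMap x) := by
  have h1 : star (1 : ComplexOctonion) = 1 := by apply ComplexOctonion.ext <;> simp
  simp only [quaternionMap_apply, star_add', star_smul', h1, star_i, star_j, star_k,
    Quaternion.re_star, Quaternion.imI_star, Quaternion.imJ_star, Quaternion.imK_star]
  module

theorem re_quaternionMap_mul_e (x : ℍ[ℂ]) : (B.quaternionMap x * B.e).re = 0 := by
  simp only [quaternionMap_apply, add_mul, smul_mul_assoc, one_mul, re_add, re_smul, B.re_i_e,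
    B.re_j_e, B.re_k_e, star_eq_neg_iff_re_eq_zero.1 B.star_e, mul_zero, add_zero]

/-- The endomorphism of the octonions defined by a basic triple. -/
def toLinearMap : ComplexOctonion →ₗ[ℂ] ComplexOctonion where
  toFun z := B.quaternionMap z.fst + B.quaternionMap z.snd * B.e
  map_add' x y := by
    simp only [fst_add, snd_add, map_add, add_mul]
    abel
  map_smul' k x := by
    simp only [fst_smul, snd_smul, map_smul, smul_mul_assoc, RingHom.id_apply, smul_add]

theorem toLinearMap_apply (z : ComplexOctonion) :
    B.toLinearMap z = B.quaternionMap z.fst + B.quaternionMap z.snd * B.e := rfl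

/-- The image of H is orthogonal to e and closed under products and conjugation, so the three
Cayley-Dickson relations apply to every mixed product. -/
theorem toLinearMap_mul (x y : ComplexOctonion) :
    B.toLinearMap (x * y) = B.toLinearMap x * B.toLinearMap y := by
  have h (u v : ℍ[ℂ]) : (B.quaternionMap u * B.quaternionMap v * B.e).re = 0 := by
    rw [← quaternionMap_mul, re_quaternionMap_mul_e]
  simp only [toLinearMap_apply, fst_mul, snd_mul, map_sub, map_add, quaternionMap_mul,
    quaternionMap_star, mul_add, add_mul]
  rw [mul_mul_right_of_orthogonal B.star_e (B.re_quaternionMap_mul_e _)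
      (B.re_quaternionMap_mul_e _) (h _ _),
    mul_mul_left_of_orthogonal B.star_e (B.re_quaternionMap_mul_e _),
    mul_mul_mul_of_orthogonal B.star_e B.normSq_e (B.re_quaternionMap_mul_e _)
      (B.re_quaternionMap_mul_e _) (by rw [← quaternionMap_star, h])]
  abel

theorem toLinearMap_star (x : ComplexOctonion) :
    B.toLinearMap (star x) = star (B.toLinearMap x) := by
  rw [toLinearMap_apply, toLinearMap_apply, star_add',
    star_eq_neg_iff_re_eq_zero.2 (B.re_quaternionMap_mul_e _), fst_star, snd_star, map_neg, neg_mul,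
    quaternionMap_star]

theorem toLinearMap_one : B.toLinearMap 1 = 1 := by
  simp [toLinearMap_apply, quaternionMap_apply]

theorem re_toLinearMap (x : ComplexOctonion) : (B.toLinearMap x).re = x.re := by
  have h := congrArg B.toLinearMap (add_star_self x)
  rw [map_add, toLinearMap_star, map_smul, toLinearMap_one, add_star_self] at h
  have := congrArg re h
  simpa [re] using this

theorem normSq_toLinearMap (x : ComplexOctonion) : (B.toLinearMap x).normSq = x.normSq := by
  rw [normSq, normSq, ← toLinearMap_star, ← toLinearMap_mul, re_toLinearMap]

/-- A multiplicative map that preserves Re preserves the nondegenerate form Re(xy). -/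
theorem toLinearMap_injective : Function.Injective B.toLinearMap := by
  rw [injective_iff_map_eq_zero]
  intro x hx
  apply eq_zero_of_re_mul_eq_zero
  intro y
  rw [← B.re_toLinearMap, toLinearMap_mul, hx, zero_mul]
  rfl

instance : Module.Finite ℂ ComplexOctonion := .of_basis basis

/-- The automorphism of the octonions defined by a basic triple. -/
def toLinearEquiv : ComplexOctonion ≃ₗ[ℂ] ComplexOctonion :=
  LinearEquiv.ofInjectiveEndo B.toLinearMap B.toLinearMap_injective

theorem toLinearEquiv_apply (x : ComplexOctonion) : B.toLinearEquiv x = B.toLinearMap x := rfl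

theorem det_pencil_toLinearMap (t : ℂ) (a b c : ComplexOctonion) :
    LinearMap.det (pencil t (B.toLinearMap a) (B.toLinearMap b) (B.toLinearMap c)) =
      LinearMap.det (pencil t a b c) := by
  rw [← LinearMap.det_conj (pencil t a b c) B.toLinearEquiv]
  congr 1
  apply LinearMap.ext
  intro x
  obtain ⟨x, rfl⟩ := B.toLinearEquiv.surjective x
  simp only [LinearMap.comp_apply, LinearEquiv.coe_coe, LinearEquiv.symm_apply_apply]
  simp only [toLinearEquiv_apply, pencil_apply, map_add, map_smul, toLinearMap_mul, toLinearMap_star]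

theorem pencilDet_toLinearMap (t : ℂ) (a b c : ComplexOctonion) :
    pencilDet t (B.toLinearMap a) (B.toLinearMap b) (B.toLinearMap c) = pencilDet t a b c := by
  simp only [pencilDet, ← toLinearMap_star, ← toLinearMap_mul, re_toLinearMap, normSq_toLinearMap]

theorem det_pencil_of_mem_range (t : ℂ) (u v : ℍ[ℂ]) (c : ComplexOctonion) :
    LinearMap.det (pencil t (B.quaternionMap u) (B.quaternionMap v) c) =
      pencilDet t (B.quaternionMap u) (B.quaternionMap v) c := by
  obtain ⟨c, rfl⟩ := B.toLinearEquiv.surjective c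
  have h (w : ℍ[ℂ]) : B.quaternionMap w = B.toLinearMap ⟨w, 0⟩ := by simp [toLinearMap_apply]
  rw [h, h, toLinearEquiv_apply, det_pencil_toLinearMap, pencilDet_toLinearMap,
    det_pencil_of_snd_eq_zero]

end BasicTriple

/-! ### Gram-Schmidt for a complex quadratic form, and existence of basic triples. -/

theorem re_one : (1 : ComplexOctonion).re = 1 := by simp [re]

theorem re_neg (x : ComplexOctonion) : (-x).re = -x.re := by
  rw [← neg_one_smul ℂ, re_smul, neg_one_mul]

theorem re_sub (x y : ComplexOctonion) : (x - y).re = x.re - y.re := by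
  rw [sub_eq_add_neg, re_add, re_neg, sub_eq_add_neg]

theorem normSq_smul (k : ℂ) (x : ComplexOctonion) : (k • x).normSq = k ^ 2 * x.normSq := by
  rw [normSq, normSq, star_smul', smul_mul_smul_comm, re_smul, pow_two]

theorem normSq_of_re_eq_zero {x : ComplexOctonion} (h : x.re = 0) : x.normSq = -(x * x).re := by
  rw [normSq, star_eq_neg_iff_re_eq_zero.2 h, mul_neg, re_neg]

/-- `|x'|²` for the imaginary part `x'` of `x`. -/
def imNormSq (x : ComplexOctonion) : ℂ := x.normSq - x.re ^ 2

/-- The Gram determinant of the imaginary parts of `x` and `y`. -/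
def imGram (x y : ComplexOctonion) : ℂ :=
  x.imNormSq * y.imNormSq - (x.re * y.re - (x * y).re) ^ 2

theorem exists_eq_re_add_smul {x : ComplexOctonion} (h : x.imNormSq ≠ 0) :
    ∃ (i : ComplexOctonion) (r : ℂ), r ^ 2 = x.imNormSq ∧ star i = -i ∧ i.normSq = 1 ∧ x = x.re • 1 + r • i := by
  obtain ⟨r, hr⟩ := IsAlgClosed.exists_pow_nat_eq x.imNormSq zero_lt_two
  have hr0 : r ≠ 0 := by
    rintro rfl
    apply h
    rw [← hr]
    simp
  have h0 : (x - x.re • 1).re = 0 := by rw [re_sub, re_smul, re_one, mul_one, sub_self]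
  have h1 : (r⁻¹ • (x - x.re • 1)).re = 0 := by rw [re_smul, h0, mul_zero]
  refine ⟨r⁻¹ • (x - x.re • 1), r, hr, star_eq_neg_iff_re_eq_zero.2 h1, ?_, ?_⟩
  · have h2 : (x - x.re • 1).normSq = x.imNormSq := by
      rw [sub_eq_add_neg, normSq_add, ← neg_smul, normSq_smul, star_smul', mul_smul_comm, re_smul,
        imNormSq]
      simp [normSq, re]
      ring
    rw [normSq_smul, h2, ← hr]
    field_simp
  · rw [smul_inv_smul₀ hr0]
    abel

/-- Pythagoras for the projection of w to the orthogonal complement of 1, i, j, k. The signs differ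
because ⟨w, i⟩ = −Re(wi) for imaginary i. -/
theorem normSq_projection {i j k : ComplexOctonion} (hi : i.normSq = 1) (hj : j.normSq = 1)
    (hk : k.normSq = 1) (hi0 : i.re = 0) (hj0 : j.re = 0) (hk0 : k.re = 0) (hij : (i * j).re = 0)
    (hik : (i * k).re = 0) (hjk : (j * k).re = 0) (w : ComplexOctonion) :
    (w + (-w.re) • 1 + (w * i).re • i + (w * j).re • j + (w * k).re • k).normSq =
      w.normSq - w.re ^ 2 - (w * i).re ^ 2 - (w * j).re ^ 2 - (w * k).re ^ 2 := by
  have h1 : star (1 : ComplexOctonion) = 1 := by apply ComplexOctonion.ext <;> simp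
  simp only [normSq_add, normSq_smul, star_smul', h1, star_eq_neg_iff_re_eq_zero.2 hi0,
    star_eq_neg_iff_re_eq_zero.2 hj0, star_eq_neg_iff_re_eq_zero.2 hk0, hi, hj, hk, add_mul,
    mul_neg, smul_neg, smul_mul_assoc, mul_smul_comm, re_add, re_neg, re_smul, hij, hik, hjk, hi0,
    hj0, hk0, one_mul, mul_one]
  have h2 : (1 : ComplexOctonion).normSq = 1 := by simp [normSq, re]
  rw [h2]
  ring

theorem sum_normSq_basis : ∑ m, (basis m).normSq = 8 := by
  simp only [basis, Module.Basis.coe_ofEquivFun, normSq, re, Fin.sum_univ_eight]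
  simp
  norm_num

theorem sum_re_basis_mul_sq (x : ComplexOctonion) : ∑ m, (basis m * x).re ^ 2 = x.normSq := by
  simp only [basis, Module.Basis.coe_ofEquivFun, normSq, re, Fin.sum_univ_eight]
  simp
  ring

/-- Every pair of orthonormal imaginary octonions extends to a basic triple. -/
theorem exists_basicTriple {i j : ComplexOctonion} (hi : star i = -i) (hj : star j = -j)
    (hNi : i.normSq = 1) (hNj : j.normSq = 1) (hij : (i * j).re = 0) :
    ∃ B : BasicTriple, B.i = i ∧ B.j = j := by
  have hi0 := star_eq_neg_iff_re_eq_zero.1 hi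
  have hj0 := star_eq_neg_iff_re_eq_zero.1 hj
  have hNk : (i * j).normSq = 1 := by rw [normSq_mul, hNi, hNj, mul_one]
  have hik : (i * (i * j)).re = 0 := by
    rw [mul_mul_of_normSq_eq_one hi hNi, re_neg, hj0, neg_zero]
  have hjk : (j * (i * j)).re = 0 := by
    rw [re_mul_comm, mul_mul_of_normSq_eq_one' hj hNj, re_neg, hi0, neg_zero]
  have hii : (i * i).re = -1 := by rw [← hNi, normSq_of_re_eq_zero hi0, neg_neg]
  have hjj : (j * j).re = -1 := by rw [← hNj, normSq_of_re_eq_zero hj0, neg_neg]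
  have hkk : (i * j * (i * j)).re = -1 := by rw [← hNk, normSq_of_re_eq_zero hij, neg_neg]
  have hone : (1 : ComplexOctonion).normSq = 1 := by simp [normSq, re]
  obtain ⟨w, hw⟩ : ∃ w : ComplexOctonion, w.normSq - w.re ^ 2 - (w * i).re ^ 2 - (w * j).re ^ 2 -
      (w * (i * j)).re ^ 2 ≠ 0 := by
    -- Isotropic vectors exist over ℂ, so a projection of nonzero norm must be found. Over the
    -- canonical basis the norms of the projections sum to 8 − 4 = 4, so they cannot all vanish.
    by_contra! hall
    have hsum := Finset.sum_congr (rfl : (Finset.univ : Finset (Fin 8)) = Finset.univ)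
      fun m _ => hall (basis m)
    have h1 := sum_re_basis_mul_sq 1
    simp only [mul_one] at h1
    simp only [Finset.sum_sub_distrib, sum_normSq_basis, sum_re_basis_mul_sq, h1, hNi, hNj, hNk,
      hone, Finset.sum_const_zero] at hsum
    norm_num at hsum
  rw [← normSq_projection hNi hNj hNk hi0 hj0 hij hij hik hjk w] at hw
  set p := w + (-w.re) • 1 + (w * i).re • i + (w * j).re • j + (w * (i * j)).re • (i * j) with hp
  have hji : (j * i).re = 0 := by rw [re_mul_comm, hij]
  have hki : (i * j * i).re = 0 := by rw [re_mul_comm, hik]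
  have hkj : (i * j * j).re = 0 := by rw [re_mul_comm, hjk]
  have hp0 : p.re = 0 := by
    simp only [hp, re_add, re_smul, re_one, hi0, hj0, hij]
    ring
  have hip : (i * p).re = 0 := by
    rw [re_mul_comm]
    simp only [hp, add_mul, smul_mul_assoc, one_mul, re_add, re_smul, hi0, hii, hji, hki]
    ring
  have hjp : (j * p).re = 0 := by
    rw [re_mul_comm]
    simp only [hp, add_mul, smul_mul_assoc, one_mul, re_add, re_smul, hj0, hij, hjj, hkj]
    ring
  have hkp : (i * j * p).re = 0 := by
    rw [re_mul_comm]
    simp only [hp, add_mul, smul_mul_assoc, one_mul, re_add, re_smul, hij, hik, hjk, hkk]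
    ring
  have him : p.imNormSq = p.normSq := by rw [imNormSq, hp0]; ring
  obtain ⟨e, r, hr, he, hNe, hpe⟩ := exists_eq_re_add_smul (x := p) (by rwa [him])
  rw [hp0, zero_smul, zero_add] at hpe
  have hr0 : r ≠ 0 := by
    rintro rfl
    apply hw
    rw [← him, ← hr]
    simp
  rw [hpe, mul_smul_comm, re_smul] at hip hjp hkp
  exact ⟨⟨i, j, e, hi, hj, he, hNi, hNj, hNe, hij, (mul_eq_zero.1 hip).resolve_left hr0,
    (mul_eq_zero.1 hjp).resolve_left hr0, (mul_eq_zero.1 hkp).resolve_left hr0⟩, rfl, rfl⟩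

/-! ### The determinant of the pencil for all a, b, c. -/

theorem det_pencil_of_imGram_ne_zero {a b : ComplexOctonion} (ha : a.imNormSq ≠ 0)
    (hab : a.imGram b ≠ 0) (t : ℂ) (c : ComplexOctonion) :
    LinearMap.det (pencil t a b c) = pencilDet t a b c := by
  obtain ⟨i, r, hr, hi, hNi, hai⟩ := exists_eq_re_add_smul ha
  have hi0 := star_eq_neg_iff_re_eq_zero.1 hi
  have hii : (i * i).re = -1 := by rw [← hNi, normSq_of_re_eq_zero hi0, neg_neg]
  set q := (i * b).re with hq
  have hq' : (b * i).re = q := re_mul_comm _ _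
  set b' := b + q • i with hb'
  have hb're : b'.re = b.re := by rw [hb', re_add, re_smul, hi0]; ring
  have hib' : (i * b').re = 0 := by
    rw [hb', mul_add, mul_smul_comm, re_add, re_smul, hii]
    ring
  have hNb' : b'.imNormSq = b.imNormSq - q ^ 2 := by
    rw [imNormSq, imNormSq, hb're, hb', normSq_add, normSq_smul, star_smul', hi, hNi, smul_neg,
      mul_neg, mul_smul_comm, re_neg, re_smul, hq']
    ring
  -- The Gram determinant equals r² times the imaginary norm of b' = b − ⟨b, i⟩i.
  have hb'0 : b'.imNormSq ≠ 0 := by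
    intro h0
    apply hab
    have h1 : (a * b).re = a.re * b.re + r * q := by
      nth_rewrite 1 [hai]
      rw [add_mul, smul_mul_assoc, smul_mul_assoc, one_mul, re_add, re_smul, re_smul]
    rw [imGram, h1, ← hr]
    linear_combination r ^ 2 * (h0 - hNb')
  obtain ⟨j, r', hr', hj, hNj, hbj⟩ := exists_eq_re_add_smul hb'0
  have hr'0 : r' ≠ 0 := by
    rintro rfl
    apply hb'0
    rw [← hr']
    simp
  have hij : (i * j).re = 0 := by
    rw [hbj, mul_add, mul_smul_comm, mul_smul_comm, mul_one, re_add, re_smul, re_smul, hi0,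
      mul_zero, zero_add] at hib'
    exact (mul_eq_zero.1 hib').resolve_left hr'0
  obtain ⟨B, hBi, hBj⟩ := exists_basicTriple hi hj hNi hNj hij
  have h1 : a = B.quaternionMap ⟨a.re, r, 0, 0⟩ := by
    refine hai.trans (Eq.trans ?_ (B.quaternionMap_apply _).symm)
    change _ = a.re • 1 + r • B.i + (0 : ℂ) • B.j + (0 : ℂ) • (B.i * B.j)
    rw [hBi, zero_smul, zero_smul, add_zero, add_zero]
  have h2 : b = B.quaternionMap ⟨b.re, -q, r', 0⟩ := by
    refine Eq.trans ?_ (B.quaternionMap_apply _).symm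
    change b = b.re • 1 + (-q) • B.i + r' • B.j + (0 : ℂ) • (B.i * B.j)
    rw [hBi, hBj, ← hb're, zero_smul, add_zero, add_right_comm, ← hbj, hb', neg_smul, add_neg_cancel_right]
  rw [h1, h2]
  exact B.det_pencil_of_mem_range t _ _ c

theorem L_add (x y : ComplexOctonion) : L (x + y) = L x + L y := by
  ext i j; simp only [Matrix.add_apply, L_apply, add_mul, mul_add, re_add]

theorem L_smul (k : ℂ) (x : ComplexOctonion) : L (k • x) = k • L x := by
  ext i j
  simp only [Matrix.smul_apply, L_apply, smul_mul_assoc, mul_smul_comm, re_smul, smul_eq_mul]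

theorem det_pencil (t : ℂ) (a b c : ComplexOctonion) :
    LinearMap.det (pencil t a b c) = pencilDet t a b c := by
  -- The line joins (a, b) at s = 0 to the orthonormal pair (i, j) at s = 1. The genericity function
  -- g is entire and nonzero at 1, so it has no zero in some punctured neighbourhood of 0.
  let i : ComplexOctonion := coords.symm (Pi.single 1 1)
  let j : ComplexOctonion := coords.symm (Pi.single 2 1)
  let x : ℂ → ComplexOctonion := fun s => (1 - s) • a + s • i
  let y : ℂ → ComplexOctonion := fun s => (1 - s) • b + s • j
  let g : ℂ → ℂ := fun s => (x s).imNormSq * (x s).imGram (y s)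
  have hg : Differentiable ℂ g := by
    simp only [g, x, y, imGram, imNormSq, normSq_add, normSq_smul, star_smul', add_mul, mul_add,
      smul_mul_assoc, mul_smul_comm, re_add, re_smul]
    fun_prop
  have hg1 : g 1 ≠ 0 := by
    simp [g, x, y, imGram, imNormSq, i, j, normSq, re]
  have hF : Continuous fun s => LinearMap.det (pencil t (x s) (y s) c) := by
    simp only [← det_toMatrix_pencil, x, y, star_add', star_smul', L_add, L_smul]
    fun_prop
  have hG : Continuous fun s => pencilDet t (x s) (y s) c := by
    simp only [pencilDet, x, y, normSq_add, normSq_smul, star_smul', add_mul, mul_add,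
      smul_mul_assoc, mul_smul_comm, re_add, re_smul]
    fun_prop
  have hev : ∀ᶠ s in nhdsWithin (0 : ℂ) {0}ᶜ, g s ≠ 0 := by
    have han : AnalyticOnNhd ℂ g Set.univ := fun s _ => hg.analyticAt s
    rcases (hg.analyticAt 0).eventually_eq_zero_or_eventually_ne_zero with h | h
    · exact absurd (han.eqOn_zero_of_preconnected_of_eventuallyEq_zero isPreconnected_univ
        (Set.mem_univ 0) h (Set.mem_univ 1)) hg1
    · exact h
  have heq : (fun s => LinearMap.det (pencil t (x s) (y s) c)) =ᶠ[nhdsWithin (0 : ℂ) {0}ᶜ]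
      fun s => pencilDet t (x s) (y s) c := by
    filter_upwards [hev] with s hs
    exact det_pencil_of_imGram_ne_zero (left_ne_zero_of_mul hs) (right_ne_zero_of_mul hs) t c
  have := tendsto_nhds_unique ((hF.tendsto 0).mono_left nhdsWithin_le_nhds)
    (((hG.tendsto 0).mono_left nhdsWithin_le_nhds).congr' heq.symm)
  simpa [x, y] using this

end ComplexOctonion


/-! ### From the 24 × 24 matrix to the pencil, and rank against determinant. -/

/-- A double Schur complement for a `3 × 3` block matrix whose diagonal blocks are homotheties. -/
theorem Matrix.det_fromBlocks_three_smul_one {n : Type*} [Fintype n] [DecidableEq n]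
    {P Q M P' Q' M' : Matrix n n ℂ} {p q m : ℂ} (hP : P' * P = p • 1) (hQ : Q' * Q = q • 1)
    (hQ' : Q * Q' = q • 1) (hM : M * M' = m • 1) (x y z : ℂ) :
    (Matrix.fromBlocks (x • (1 : Matrix n n ℂ)) (Matrix.fromCols P Q) (Matrix.fromRows P' Q')
      (Matrix.fromBlocks (y • (1 : Matrix n n ℂ)) M M' (z • (1 : Matrix n n ℂ)))).det =
    ((x * y * z - x * m - y * q - z * p) • 1 + M * (Q' * P) + P' * (Q * M')).det := by
  refine congrFun (Continuous.ext_on (f := fun x : ℂ =>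
    (Matrix.fromBlocks (x • (1 : Matrix n n ℂ)) (Matrix.fromCols P Q) (Matrix.fromRows P' Q')
      (Matrix.fromBlocks (y • (1 : Matrix n n ℂ)) M M' (z • (1 : Matrix n n ℂ)))).det)
    (g := fun x : ℂ =>
      ((x * y * z - x * m - y * q - z * p) • 1 + M * (Q' * P) + P' * (Q * M')).det)
    (dense_compl_singleton (0 : ℂ)) ?_ ?_ ?_) x
  · apply Continuous.matrix_det
    apply Continuous.matrix_fromBlocks <;> fun_prop
  · fun_prop
  · intro x hx
    have hx : x ≠ 0 := hx
    let inv : Invertible (x • (1 : Matrix n n ℂ)) :=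
      ⟨x⁻¹ • 1, by simp [smul_smul, hx], by simp [smul_smul, hx]⟩
    have hinv : ⅟(x • (1 : Matrix n n ℂ)) = x⁻¹ • 1 := rfl
    -- Since P'P and Q'Q are scalar, the diagonal blocks stay homotheties and a second Schur
    -- complement applies.
    have hschur : Matrix.fromBlocks (y • (1 : Matrix n n ℂ)) M M' (z • (1 : Matrix n n ℂ)) -
        Matrix.fromRows P' Q' * (x⁻¹ • 1 : Matrix n n ℂ) * Matrix.fromCols P Q =
        Matrix.fromBlocks ((y - x⁻¹ * p) • 1) (M - x⁻¹ • (P' * Q)) (M' - x⁻¹ • (Q' * P))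
          ((z - x⁻¹ * q) • 1) := by
      rw [Matrix.mul_smul, Matrix.mul_one, Matrix.smul_mul, Matrix.fromRows_mul_fromCols, hP, hQ,
        Matrix.fromBlocks_smul, sub_eq_add_neg, Matrix.fromBlocks_neg, Matrix.fromBlocks_add]
      congr 1 <;> module
    have hprod : P' * Q * (Q' * P) = (p * q) • 1 := by
      rw [mul_assoc, ← mul_assoc Q, hQ', smul_mul_assoc, one_mul, mul_smul_comm, hP, smul_smul,
        mul_comm]
    -- The factor xⁿ of the first complement is absorbed as a scalar x inside the determinant. The
    -- two terms pq/x, one from the diagonal and one from P'QQ'P, then cancel.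
    simp only [Matrix.det_fromBlocks₁₁, hinv]
    rw [hschur, Matrix.det_fromBlocks_smul_one, Matrix.det_smul, Matrix.det_one, mul_one,
      ← Matrix.det_smul, sub_mul, mul_sub, mul_sub, hM, smul_mul_smul_comm, hprod, smul_mul_assoc,
      mul_smul_comm, mul_assoc P']
    congr 1
    match_scalars
    · field_simp
      ring
    · field_simp
    · field_simp

theorem Matrix.rank_lt_card_iff_det_eq_zero {n : Type*} [Fintype n] [DecidableEq n]
    (M : Matrix n n ℂ) : M.rank < Fintype.card n ↔ M.det = 0 := by
  constructor
  · intro h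
    by_contra h0
    exact h.ne (Matrix.rank_of_det_ne_zero h0)
  · intro h
    refine lt_of_le_of_ne (Matrix.rank_le_card_width M) fun hr => ?_
    have htop : LinearMap.range M.mulVecLin = ⊤ :=
      Submodule.eq_top_of_finrank_eq (by rw [Module.finrank_fintype_fun_eq_card]; exact hr)
    have hu : IsUnit M := Matrix.mulVec_surjective_iff_isUnit.1 (LinearMap.range_eq_top.1 htop)
    exact ((Matrix.isUnit_iff_isUnit_det M).1 hu).ne_zero h

namespace ComplexOctonion

theorem L_mul_L_star (a : ComplexOctonion) : L a * L (star a) = a.normSq • 1 := by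
  rw [L, L, ← LinearMap.toMatrix_comp basis basis basis, ← LinearMap.toMatrix_id basis, ← map_smul]
  congr 1
  exact LinearMap.ext (mul_star_mul_self a)

theorem L_star_mul_L (a : ComplexOctonion) : L (star a) * L a = a.normSq • 1 := by
  rw [L, L, ← LinearMap.toMatrix_comp basis basis basis, ← LinearMap.toMatrix_id basis, ← map_smul]
  congr 1
  exact LinearMap.ext (star_mul_mul_self a)

theorem R_star_mul_R (a : ComplexOctonion) : R (star a) * R a = a.normSq • 1 := by
  rw [R, R, ← LinearMap.toMatrix_comp basis basis basis, ← LinearMap.toMatrix_id basis, ← map_smul]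
  congr 1
  exact LinearMap.ext (mul_mul_star_self a)

end ComplexOctonion

-- Here t + 2 Re(c̄ba) is the cubic, and 𝔖 is the expansion of (t + 2 Re(c)Re(ab))² − 4(|a|²|b|² −
-- Re(ab)²)(|c|² − Re(c)²).
open ComplexOctonion in
theorem HermitianOctonionMatrix.det_twistedMatrix (A : HermitianOctonionMatrix) :
    A.twistedMatrix.det = A.twistedCubic ^ 4 * A.sextic ^ 2 := by
  rw [twistedMatrix, Matrix.det_fromBlocks_three_smul_one (p := A.c.normSq) (q := A.b.normSq)
    (m := A.a.normSq) (by rw [R_transpose, R_star_mul_R]) (by rw [L_transpose, L_mul_L_star])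
    (by rw [L_transpose, L_star_mul_L]) (by rw [L_transpose, L_mul_L_star]),
    R_transpose, L_transpose, L_transpose, det_toMatrix_pencil, det_pencil, pencilDet,
    twistedCubic, octDet, sextic]
  ring

end

theorem mainTheorem2 :
    HermitianOctonionMatrix.twistedDegeneracyLocus =
        {A : HermitianOctonionMatrix | A.twistedCubic ^ 4 * A.sextic ^ 2 = 0} ∧
      ∀ A : HermitianOctonionMatrix,
        A.twistedMatrix.det = A.twistedCubic ^ 4 * A.sextic ^ 2 := by
  refine ⟨?_, HermitianOctonionMatrix.det_twistedMatrix⟩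
  ext A
  rw [Set.mem_ofPred_eq, ← A.det_twistedMatrix, ← Matrix.rank_lt_card_iff_det_eq_zero]
  -- The index type `Fin 8 ⊕ (Fin 8 ⊕ Fin 8)` has cardinality 24 by evaluation.
  rfl
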